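/- Order $\mathbb N^2$ componentwise and write $\alpha\wedge\beta$ for the componentwise minimum. Write $\alpha\ll\beta$ if $\alpha_1<\beta_1$ and $\alpha_2<\beta_2$, and $\alpha\le\le\beta$ if $\alpha=\beta$ or $\alpha\ll\beta$. A submonoid $S$ of $(\mathbb N^2,+)$ is a good semigroup if (G1) $\alpha\wedge\beta\in S$ for all $\alpha,\beta\in S$; (G2) if $\alpha,\beta\in S$ and $\alpha_i=\beta_i$ for some $i\in\{1,2\}$, and $j$ is the other index, then there is $\delta\in S$ with $\delta_i>\alpha_i=\beta_i$ and $\delta_j\ge\min\{\alpha_j,\beta_j\}$, with equality $\delta_j=\min\{\alpha_j,\beta_j\}$ if $\alpha_j\ne\beta_j$; (G3) there is $c\in S$ with $c+\mathbb N^2\subseteq S$. It is local if $(0,0)$ is its only element with a zero component. Let $S\subseteq\mathbb N^2$ be a local good semigroup, let $e=(e_1,e_2)$ be its smallest nonzero element, and let $\mathrm{Ap}(S)=\{\alpha\in S:\alpha-e\notin S\}$ be its Apéry set. For $i\ge 1$ define recursively $$B^{(i)}=\Big\{\alpha\in \mathrm{Ap}(S)\setminus\bigcup_{1\le j<i}D^{(j)}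 : \alpha \text{ is maximal in this set with respect to } \le\le\Big\},$$ $$C^{(i)}=\{\alpha\in B^{(i)}:\alpha=\beta_1\wedge\beta_2\text{ for some }\beta_1,\beta_2\in B^{(i)}\setminus\{\alpha\}\},\qquad D^{(i)}=B^{(i)}\setminus C^{(i)}.$$ Theorem. There is exactly one $N\in\mathbb N$ such that the sets $A_i=D^{(N+1-i)}$, $1\le i\le N$ (the levels), are nonempty, pairwise disjoint and have union $\mathrm{Ap}(S)$, and this $N$ is $N=e_1+e_2$. -/

import Mathlib

namespace GoodSemigroup

/-- A submonoid `S` of `(ℕ², +)` is a good semigroup. The order and the infimum `⊓` on `ℕ × ℕ`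
are the componentwise ones. -/
structure IsGood (S : AddSubmonoid (ℕ × ℕ)) : Prop where
  inf_mem : ∀ α ∈ S, ∀ β ∈ S, α ⊓ β ∈ S
  exists_of_fst_eq : ∀ α ∈ S, ∀ β ∈ S, α.1 = β.1 →
    ∃ δ ∈ S, α.1 < δ.1 ∧ min α.2 β.2 ≤ δ.2 ∧ (α.2 ≠ β.2 → δ.2 = min α.2 β.2)
  exists_of_snd_eq : ∀ α ∈ S, ∀ β ∈ S, α.2 = β.2 →
    ∃ δ ∈ S, α.2 < δ.2 ∧ min α.1 β.1 ≤ δ.1 ∧ (α.1 ≠ β.1 → δ.1 = min α.1 β.1)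
  exists_conductor : ∃ c ∈ S, ∀ ν : ℕ × ℕ, c + ν ∈ S

/-- `S` is local: `0` is its only element with a zero component. -/
def IsLocal (S : AddSubmonoid (ℕ × ℕ)) : Prop :=
  ∀ α ∈ S, α.1 = 0 ∨ α.2 = 0 → α = 0

/-- `e` is the smallest nonzero element of `S` (for the componentwise order). -/
def IsMinNonzero (S : AddSubmonoid (ℕ × ℕ)) (e : ℕ × ℕ) : Prop :=
  IsLeast {α : ℕ × ℕ | α ∈ S ∧ α ≠ 0} e

/-- The Apéry set of `S` with respect to `β`: the `α ∈ S` with `α - β ∉ S`, the difference being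
taken in `ℤ²`; that is, the `α ∈ S` which are not of the form `β + δ` with `δ ∈ S`. -/
def apery (S : AddSubmonoid (ℕ × ℕ)) (β : ℕ × ℕ) : Set (ℕ × ℕ) :=
  {α | α ∈ S ∧ ¬ ∃ δ ∈ S, α = β + δ}

/-- `α ≪ β`: strict inequality in both components. -/
def StrictlyBelow (α β : ℕ × ℕ) : Prop :=
  α.1 < β.1 ∧ α.2 < β.2

/-- The relation `≤≤` on `ℕ²`. -/
def LELE (α β : ℕ × ℕ) : Prop :=
  α = β ∨ (α ≠ β ∧ StrictlyBelow α β)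

/-- The elements of `T` that are maximal in `T` with respect to `≤≤`. -/
def maximals (T : Set (ℕ × ℕ)) : Set (ℕ × ℕ) :=
  {α | α ∈ T ∧ ∀ β ∈ T, LELE α β → β = α}

/-- The elements of `B` that are the infimum of two elements of `B`, both different from it. -/
def infima (B : Set (ℕ × ℕ)) : Set (ℕ × ℕ) :=
  {α | α ∈ B ∧ ∃ β₁ ∈ B \ {α}, ∃ β₂ ∈ B \ {α}, α = β₁ ⊓ β₂}

/-- What is removed from `T` in one step: the maximal elements of `T` that are not infima of two
other maximal elements. -/
def topLayer (T : Set (ℕ × ℕ)) : Set (ℕ × ℕ) :=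
  maximals T \ infima (maximals T)

/-- The sets `D⁽¹⁾, D⁽²⁾, …` attached to a set `T`, where `D⁽ⁱ⁾` is what is removed from
`T` without `D⁽¹⁾, …, D⁽ⁱ⁻¹⁾`. Only indices `i ≥ 1` are meaningful. -/
def layer (T : Set (ℕ × ℕ)) (i : ℕ) : Set (ℕ × ℕ) :=
  topLayer (T \ ⋃ j : {j : ℕ // 1 ≤ j ∧ j < i}, layer T j.1)
termination_by i
decreasing_by exact j.2.2

/-- The sets `A_i = D⁽ᴺ⁺¹⁻ⁱ⁾` (`1 ≤ i ≤ N`) for the Apéry set of `S` with respect to `e`: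
the same sets numbered in increasing order. -/
def level (S : AddSubmonoid (ℕ × ℕ)) (e : ℕ × ℕ) (N i : ℕ) : Set (ℕ × ℕ) :=
  layer (apery S e) (N + 1 - i)

/-- `N` is the number of levels of the Apéry set: `A_1, …, A_N` are nonempty, pairwise disjoint
and their union is the whole Apéry set. -/
structure IsNumberOfLevels (S : AddSubmonoid (ℕ × ℕ)) (e : ℕ × ℕ) (N : ℕ) : Prop where
  nonempty : ∀ i ∈ Set.Icc 1 N, (level S e N i).Nonempty
  pairwiseDisjoint : (Set.Icc 1 N).PairwiseDisjoint (level S e N)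
  iUnion_eq : ⋃ i ∈ Set.Icc 1 N, level S e N i = apery S e

end GoodSemigroup

namespace GoodSemigroup

/-! Walk from the origin by unit steps and count those leaving a half-line (column going up, row
going right) that meets a good set `E`; by `IsGoodSet.indicator_square` the count `len` depends only
on the endpoint. The `height`, the count for `S` minus the count for `e + S`, grows by 0 or 1 at
each step, from 0 at the origin to `e.1 + e.2` far out. It is strictly larger at any point strictly
above an Apéry element (`height_lt_height`), and every value below `e.1 + e.2` is attained on the
Apéry set (`exists_mem_apery_height_eq`). By `topLayer_height_le`, each removal takes exactly the
Apéry elements of greatest remaining height, so layers are level sets of the height, and there are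
`e.1 + e.2` of them. -/

open Classical in
/-- The indicator of a proposition, as an integer. -/
noncomputable def indicator (p : Prop) : ℤ := if p then 1 else 0

lemma indicator_pos {p : Prop} (h : p) : indicator p = 1 := if_pos h

lemma indicator_neg {p : Prop} (h : ¬ p) : indicator p = 0 := if_neg h

lemma indicator_congr {p q : Prop} (h : p ↔ q) : indicator p = indicator q := by
  rw [propext h]

/-! ### Path-independent counting in good sets -/

/-- `E` meets the vertical half-line going up from `(x, y)`. -/
def MeetsCol (E : Set (ℕ × ℕ)) (x y : ℕ) : Prop := ∃ z, y ≤ z ∧ (x, z) ∈ E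

/-- `E` meets the horizontal half-line going right from `(x, y)`. -/
def MeetsRow (E : Set (ℕ × ℕ)) (x y : ℕ) : Prop := ∃ z, x ≤ z ∧ (z, y) ∈ E

/-- Closure under infima together with the exchange property of good semigroups. -/
structure IsGoodSet (E : Set (ℕ × ℕ)) : Prop where
  inf_mem : ∀ {x y x' y'}, (x, y') ∈ E → (x', y) ∈ E → x ≤ x' → y ≤ y' → (x, y) ∈ E
  meetsCol_iff_meetsRow : ∀ {x y}, (x, y) ∈ E → (MeetsCol E x (y + 1) ↔ MeetsRow E (x + 1) y)

/-- The number of unit steps `p → p + (1, 0)` or `p → p + (0, 1)` on the path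
`(0, 0) → (a, 0) → (a, b)` which leave a half-line that meets `E`. -/
noncomputable def len (E : Set (ℕ × ℕ)) (a b : ℕ) : ℤ :=
  ∑ x ∈ Finset.range a, indicator (MeetsCol E x 0) +
    ∑ y ∈ Finset.range b, indicator (MeetsRow E a y)

lemma meetsCol_iff (E : Set (ℕ × ℕ)) (x y : ℕ) :
    MeetsCol E x y ↔ (x, y) ∈ E ∨ MeetsCol E x (y + 1) := by
  constructor
  · rintro ⟨z, hz, h⟩
    rcases hz.eq_or_lt with rfl | hlt
    · exact Or.inl h
    · exact Or.inr ⟨z, hlt, h⟩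
  · rintro (h | ⟨z, hz, h⟩)
    · exact ⟨y, le_rfl, h⟩
    · exact ⟨z, by omega, h⟩

lemma meetsRow_iff (E : Set (ℕ × ℕ)) (x y : ℕ) :
    MeetsRow E x y ↔ (x, y) ∈ E ∨ MeetsRow E (x + 1) y := by
  constructor
  · rintro ⟨z, hz, h⟩
    rcases hz.eq_or_lt with rfl | hlt
    · exact Or.inl h
    · exact Or.inr ⟨z, hlt, h⟩
  · rintro (h | ⟨z, hz, h⟩)
    · exact ⟨x, le_rfl, h⟩
    · exact ⟨z, by omega, h⟩

lemma IsGoodSet.mem_of_meets {E : Set (ℕ × ℕ)} (hE : IsGoodSet E) {x y : ℕ}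
    (hc : MeetsCol E x y) (hr : MeetsRow E x y) : (x, y) ∈ E := by
  obtain ⟨z, hz, h⟩ := hc
  obtain ⟨w, hw, h'⟩ := hr
  exact hE.inf_mem h h' hw hz

/-- At a point of `E` the exchange property matches the two shifted half-lines; off `E`, shifting a
half-line by one loses nothing. Hence both ways around a unit square cost the same. -/
lemma IsGoodSet.indicator_square {E : Set (ℕ × ℕ)} (hE : IsGoodSet E) (x y : ℕ) :
    indicator (MeetsCol E x y) + indicator (MeetsRow E (x + 1) y) =
      indicator (MeetsRow E x y) + indicator (MeetsCol E x (y + 1)) := by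
  by_cases h : (x, y) ∈ E
  · rw [indicator_pos ((meetsCol_iff E x y).2 (Or.inl h)),
      indicator_pos ((meetsRow_iff E x y).2 (Or.inl h)),
      indicator_congr (hE.meetsCol_iff_meetsRow h)]
  · have h1 := meetsCol_iff E x y
    have h2 := meetsRow_iff E x y
    simp only [h, false_or] at h1 h2
    rw [indicator_congr h1, indicator_congr h2, add_comm]

lemma len_succ_snd (E : Set (ℕ × ℕ)) (a b : ℕ) :
    len E a (b + 1) = len E a b + indicator (MeetsRow E a b) := by
  rw [len, len, Finset.sum_range_succ _ b, add_assoc]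

lemma IsGoodSet.len_succ_fst {E : Set (ℕ × ℕ)} (hE : IsGoodSet E) (a b : ℕ) :
    len E (a + 1) b = len E a b + indicator (MeetsCol E a b) := by
  induction b with
  | zero => simp [len, Finset.sum_range_succ]
  | succ b ih =>
    rw [len_succ_snd, len_succ_snd, ih]
    linarith [hE.indicator_square a b]

/-! ### The translate of the semigroup -/

/-- The translate `e + S`. -/
def translate (S : AddSubmonoid (ℕ × ℕ)) (e : ℕ × ℕ) : Set (ℕ × ℕ) :=
  {α | ∃ δ ∈ S, α = e + δ}

lemma IsGood.isGoodSet {S : AddSubmonoid (ℕ × ℕ)} (hS : IsGood S) :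
    IsGoodSet (S : Set (ℕ × ℕ)) where
  inf_mem {x y x' y'} h h' hx hy := by
    have := hS.inf_mem _ h _ h'
    simpa [hx, hy] using this
  meetsCol_iff_meetsRow {x y} h := by
    constructor
    · rintro ⟨z, hz, h'⟩
      obtain ⟨⟨u, v⟩, hd, h1, -, h3⟩ := hS.exists_of_fst_eq _ h _ h' rfl
      simp only at h1 h3
      have : v = y := by rw [h3 (by omega)]; exact min_eq_left (by omega)
      exact ⟨u, h1, this ▸ hd⟩
    · rintro ⟨z, hz, h'⟩
      obtain ⟨⟨u, v⟩, hd, h1, -, h3⟩ := hS.exists_of_snd_eq _ h _ h' rfl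
      simp only at h1 h3
      have : u = x := by rw [h3 (by omega)]; exact min_eq_left (by omega)
      exact ⟨v, h1, this ▸ hd⟩

lemma mem_translate (S : AddSubmonoid (ℕ × ℕ)) (e : ℕ × ℕ) (x y : ℕ) :
    (x, y) ∈ translate S e ↔ e.1 ≤ x ∧ e.2 ≤ y ∧ (x - e.1, y - e.2) ∈ S := by
  constructor
  · rintro ⟨⟨u, v⟩, hd, h⟩
    simp only [Prod.ext_iff, Prod.fst_add, Prod.snd_add] at h
    obtain ⟨rfl, rfl⟩ := h
    exact ⟨by omega, by omega, by simpa using hd⟩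
  · rintro ⟨h1, h2, h⟩
    refine ⟨_, h, Prod.ext ?_ ?_⟩ <;> simp only [Prod.fst_add, Prod.snd_add] <;> omega

lemma add_mem_translate (S : AddSubmonoid (ℕ × ℕ)) (e : ℕ × ℕ) (x y : ℕ) :
    (x + e.1, y + e.2) ∈ translate S e ↔ (x, y) ∈ S := by
  simp [mem_translate]

lemma meetsCol_translate_add (S : AddSubmonoid (ℕ × ℕ)) (e : ℕ × ℕ) (x y : ℕ) :
    MeetsCol (translate S e) (x + e.1) (y + e.2) ↔ MeetsCol S x y := by
  constructor
  · rintro ⟨z, hz, h⟩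
    rw [mem_translate] at h
    exact ⟨z - e.2, by omega, by simpa using h.2.2⟩
  · rintro ⟨z, hz, h⟩
    exact ⟨z + e.2, by omega, (add_mem_translate S e x z).2 h⟩

lemma meetsRow_translate_add (S : AddSubmonoid (ℕ × ℕ)) (e : ℕ × ℕ) (x y : ℕ) :
    MeetsRow (translate S e) (x + e.1) (y + e.2) ↔ MeetsRow S x y := by
  constructor
  · rintro ⟨z, hz, h⟩
    rw [mem_translate] at h
    exact ⟨z - e.1, by omega, by simpa using h.2.2⟩
  · rintro ⟨z, hz, h⟩
    exact ⟨z + e.1, by omega, (add_mem_translate S e z y).2 h⟩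

lemma meetsCol_translate_add_zero (S : AddSubmonoid (ℕ × ℕ)) (e : ℕ × ℕ) (x : ℕ) :
    MeetsCol (translate S e) (x + e.1) 0 ↔ MeetsCol S x 0 := by
  rw [← meetsCol_translate_add S e]
  constructor
  · rintro ⟨z, hz, h⟩
    exact ⟨z, by have := ((mem_translate S e _ _).1 h).2.1; omega, h⟩
  · rintro ⟨z, hz, h⟩
    exact ⟨z, Nat.zero_le _, h⟩

lemma IsGood.isGoodSet_translate {S : AddSubmonoid (ℕ × ℕ)} (hS : IsGood S) (e : ℕ × ℕ) :
    IsGoodSet (translate S e) where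
  inf_mem {x y x' y'} h h' hx hy := by
    rw [mem_translate] at h h' ⊢
    exact ⟨h.1, h'.2.1, hS.isGoodSet.inf_mem h.2.2 h'.2.2 (by omega) (by omega)⟩
  meetsCol_iff_meetsRow {x y} h := by
    obtain ⟨h1, h2, h⟩ := (mem_translate S e x y).1 h
    have := hS.isGoodSet.meetsCol_iff_meetsRow h
    rw [← meetsCol_translate_add S e, ← meetsRow_translate_add S e] at this
    rwa [show y - e.2 + 1 + e.2 = y + 1 by omega, show x - e.1 + 1 + e.1 = x + 1 by omega,
      show y - e.2 + e.2 = y by omega, show x - e.1 + e.1 = x by omega] at this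

lemma len_translate_add (S : AddSubmonoid (ℕ × ℕ)) (e : ℕ × ℕ) (a b : ℕ) :
    len (translate S e) (a + e.1) (b + e.2) = len S a b := by
  have h1 : ∀ x ∈ Finset.range e.1, indicator (MeetsCol (translate S e) x 0) = 0 := by
    intro x hx
    refine indicator_neg ?_
    rintro ⟨z, -, h⟩
    have := ((mem_translate S e _ _).1 h).1
    have := Finset.mem_range.1 hx
    omega
  have h2 : ∀ y ∈ Finset.range e.2, indicator (MeetsRow (translate S e) (a + e.1) y) = 0 := by
    intro x hx
    refine indicator_neg ?_
    rintro ⟨z, -, h⟩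
    have := ((mem_translate S e _ _).1 h).2.1
    have := Finset.mem_range.1 hx
    omega
  rw [len, len, add_comm a, add_comm b, Finset.sum_range_add, Finset.sum_range_add, add_comm _ a,
    Finset.sum_eq_zero h1, Finset.sum_eq_zero h2, zero_add, zero_add]
  congr 1
  · exact Finset.sum_congr rfl fun x _ => by
      rw [add_comm, indicator_congr (meetsCol_translate_add_zero S e x)]
  · exact Finset.sum_congr rfl fun y _ => by
      rw [add_comm _ y, indicator_congr (meetsRow_translate_add S e a y)]

/-! ### The height function -/

/-- The difference of the lengths of `S` and `e + S` below `(a, b)`. -/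
noncomputable def height (S : AddSubmonoid (ℕ × ℕ)) (e : ℕ × ℕ) (a b : ℕ) : ℤ :=
  len S a b - len (translate S e) a b

lemma height_zero (S : AddSubmonoid (ℕ × ℕ)) (e : ℕ × ℕ) : height S e 0 0 = 0 := by
  simp [height, len]

section

variable {S : AddSubmonoid (ℕ × ℕ)} {e : ℕ × ℕ}

lemma translate_subset (he : e ∈ S) : translate S e ⊆ S := by
  rintro _ ⟨δ, hδ, rfl⟩
  exact S.add_mem he hδ

lemma MeetsCol.mono {E F : Set (ℕ × ℕ)} (h : E ⊆ F) {x y : ℕ} : MeetsCol E x y → MeetsCol F x y :=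
  fun ⟨z, hz, hE⟩ => ⟨z, hz, h hE⟩

lemma MeetsRow.mono {E F : Set (ℕ × ℕ)} (h : E ⊆ F) {x y : ℕ} : MeetsRow E x y → MeetsRow F x y :=
  fun ⟨z, hz, hE⟩ => ⟨z, hz, h hE⟩

/-- A step to the right raises the height by one if it leaves a column that meets `S` but not
`e + S`, and keeps it otherwise. -/
lemma height_succ_fst (hS : IsGood S) (he : e ∈ S) (a b : ℕ) :
    (height S e (a + 1) b = height S e a b + 1 ∧
      MeetsCol S a b ∧ ¬ MeetsCol (translate S e) a b) ∨
    (height S e (a + 1) b = height S e a b ∧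
      (MeetsCol S a b → MeetsCol (translate S e) a b)) := by
  rw [height, height, hS.isGoodSet.len_succ_fst, (hS.isGoodSet_translate e).len_succ_fst]
  by_cases h' : MeetsCol (translate S e) a b
  · rw [indicator_pos h', indicator_pos (h'.mono (translate_subset he))]
    exact Or.inr ⟨by ring, fun _ => h'⟩
  · by_cases h : MeetsCol (S : Set (ℕ × ℕ)) a b
    · rw [indicator_pos h, indicator_neg h']
      exact Or.inl ⟨by ring, h, h'⟩
    · rw [indicator_neg h, indicator_neg h']
      exact Or.inr ⟨by ring, fun hh => absurd hh h⟩

/-- A step upwards raises the height by one if it leaves a row that meets `S` but not `e + S`, and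
keeps it otherwise. -/
lemma height_succ_snd (he : e ∈ S) (a b : ℕ) :
    (height S e a (b + 1) = height S e a b + 1 ∧
      MeetsRow S a b ∧ ¬ MeetsRow (translate S e) a b) ∨
    (height S e a (b + 1) = height S e a b ∧
      (MeetsRow S a b → MeetsRow (translate S e) a b)) := by
  rw [height, height, len_succ_snd, len_succ_snd]
  by_cases h' : MeetsRow (translate S e) a b
  · rw [indicator_pos h', indicator_pos (h'.mono (translate_subset he))]
    exact Or.inr ⟨by ring, fun _ => h'⟩
  · by_cases h : MeetsRow (S : Set (ℕ × ℕ)) a b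
    · rw [indicator_pos h, indicator_neg h']
      exact Or.inl ⟨by ring, h, h'⟩
    · rw [indicator_neg h, indicator_neg h']
      exact Or.inr ⟨by ring, fun hh => absurd hh h⟩

lemma height_mono (hS : IsGood S) (he : e ∈ S) {a b a' b' : ℕ} (ha : a ≤ a') (hb : b ≤ b') :
    height S e a b ≤ height S e a' b' := by
  calc height S e a b ≤ height S e a' b :=
        monotone_nat_of_le_succ (f := fun x => height S e x b) (fun x => by
          rcases height_succ_fst hS he x b with h | h <;> simp only [h.1] <;> omega) ha
    _ ≤ height S e a' b' :=
        monotone_nat_of_le_succ (f := fun y => height S e a' y) (fun y => by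
          rcases height_succ_snd he a' y with h | h <;> simp only [h.1] <;> omega) hb

lemma mem_of_conductor_le {c : ℕ × ℕ} (hc : ∀ ν : ℕ × ℕ, c + ν ∈ S) {x y : ℕ} (hx : c.1 ≤ x)
    (hy : c.2 ≤ y) : (x, y) ∈ S := by
  have := hc (x - c.1, y - c.2)
  rwa [show c + (x - c.1, y - c.2) = (x, y) from Prod.ext (by simp; omega) (by simp; omega)]
    at this

lemma len_add_of_conductor_le (hS : IsGood S) {c : ℕ × ℕ} (hc : ∀ ν : ℕ × ℕ, c + ν ∈ S)
    {a b : ℕ} (ha : c.1 ≤ a) (hb : c.2 ≤ b) (m n : ℕ) :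
    len S (a + m) (b + n) = len S a b + m + n := by
  have h1 : len (S : Set (ℕ × ℕ)) (a + m) b = len S a b + m := by
    induction m with
    | zero => simp
    | succ m ih =>
      rw [← add_assoc, hS.isGoodSet.len_succ_fst, ih,
        indicator_pos ⟨b, le_rfl, mem_of_conductor_le hc (by omega) hb⟩]
      push_cast; ring
  induction n with
  | zero => simp [h1]
  | succ n ih =>
    rw [← add_assoc, len_succ_snd, ih,
      indicator_pos ⟨a + m, le_rfl, mem_of_conductor_le hc (by omega) (by omega)⟩]
    push_cast; ring

lemma height_eq_of_conductor_le (hS : IsGood S) {c : ℕ × ℕ} (hc : ∀ ν : ℕ × ℕ, c + ν ∈ S)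
    {a b : ℕ} (ha : c.1 + e.1 ≤ a) (hb : c.2 + e.2 ≤ b) :
    height S e a b = e.1 + e.2 := by
  obtain ⟨a, rfl⟩ : ∃ a', a = a' + e.1 := ⟨a - e.1, by omega⟩
  obtain ⟨b, rfl⟩ : ∃ b', b = b' + e.2 := ⟨b - e.2, by omega⟩
  rw [height, len_translate_add, len_add_of_conductor_le hS hc (by omega) (by omega)]
  ring

/-- With equal heights neither first step out of `(a, b)` would count, so its column and its row
would both meet `e + S`, putting `(a, b)` in `e + S`. -/
lemma height_lt_height (hS : IsGood S) (he : e ∈ S) {a b a' b' : ℕ} (h : (a, b) ∈ apery S e)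
    (ha : a < a') (hb : b < b') : height S e a b < height S e a' b' := by
  by_contra! hle
  have h1 := height_mono hS he (show a ≤ a + 1 by omega) (le_refl b)
  have h2 := height_mono hS he (show a + 1 ≤ a' by omega) (show b ≤ b' by omega)
  have h3 := height_mono hS he (le_refl a) (show b ≤ b + 1 by omega)
  have h4 := height_mono hS he (show a ≤ a' by omega) (show b + 1 ≤ b' by omega)
  refine h.2 ((hS.isGoodSet_translate e).mem_of_meets ?_ ?_)
  · rcases height_succ_fst hS he a b with h5 | h5
    · omega
    · exact h5.2 ⟨b, le_rfl, h.1⟩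
  · rcases height_succ_snd he a b with h5 | h5
    · omega
    · exact h5.2 ⟨a, le_rfl, h.1⟩

/-- The height of an element of the Apéry set grows strictly along its row or along its column;
hence the element is not the infimum of two others of the same height. -/
lemma height_lt_of_height_le (hS : IsGood S) (he : e ∈ S) {a b a' b' : ℕ} (h : (a, b) ∈ apery S e)
    (ha : a < a') (hb : b < b') (h1 : height S e a' b ≤ height S e a b) :
    height S e a b < height S e a b' := by
  by_contra! h2
  have h3 := height_mono hS he (show a + 1 ≤ a' by omega) (le_refl b)
  have h4 := height_mono hS he (le_refl a) (show b + 1 ≤ b' by omega)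
  refine h.2 ((hS.isGoodSet_translate e).mem_of_meets ?_ ?_)
  · rcases height_succ_fst hS he a b with h5 | h5
    · omega
    · exact h5.2 ⟨b, le_rfl, h.1⟩
  · rcases height_succ_snd he a b with h5 | h5
    · omega
    · exact h5.2 ⟨a, le_rfl, h.1⟩

/-- At a maximal point of height at most `k` in a large box, every step staying inside raises the
height, so the half-lines there meet `S` but miss `e + S`. -/
lemma exists_mem_apery_height_eq (hS : IsGood S) (he : e ∈ S) {a b : ℕ} {k : ℤ}
    (hab : height S e a b ≤ k) (hk : k < e.1 + e.2) :
    ∃ x y, a ≤ x ∧ b ≤ y ∧ (x, y) ∈ apery S e ∧ height S e x y = k := by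
  obtain ⟨c, -, hc⟩ := hS.exists_conductor
  obtain ⟨m, hm⟩ : ∃ m, m = a + c.1 + e.1 := ⟨_, rfl⟩
  obtain ⟨n, hn⟩ : ∃ n, n = b + c.2 + e.2 := ⟨_, rfl⟩
  let T : Finset (ℕ × ℕ) := (Finset.Icc (a, b) (m, n)).filter fun p => height S e p.1 p.2 ≤ k
  obtain ⟨⟨x, y⟩, hp⟩ := T.exists_maximal
    ⟨(a, b), by simp only [T, Finset.mem_filter, Finset.mem_Icc, Prod.mk_le_mk]; omega⟩
  have hT : ∀ u v, (u, v) ∈ T ↔ ((a ≤ u ∧ b ≤ v) ∧ u ≤ m ∧ v ≤ n) ∧ height S e u v ≤ k := by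
    intro u v
    simp only [T, Finset.mem_filter, Finset.mem_Icc, Prod.mk_le_mk]
  have hxy := (hT x y).1 hp.prop
  have hx : x < m → height S e (x + 1) y = k + 1 ∧ height S e x y = k ∧
      MeetsCol S x y ∧ ¬ MeetsCol (translate S e) x y := by
    intro hlt
    have : (x + 1, y) ∉ T := fun hmem => by
      have := hp.le_of_ge hmem (by simp)
      simp at this
    rw [hT] at this
    rcases height_succ_fst hS he x y with h | h
    · exact ⟨by omega, by omega, h.2⟩
    · omega
  have hy : y < n → height S e x (y + 1) = k + 1 ∧ height S e x y = k ∧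
      MeetsRow S x y ∧ ¬ MeetsRow (translate S e) x y := by
    intro hlt
    have : (x, y + 1) ∉ T := fun hmem => by
      have := hp.le_of_ge hmem (by simp)
      simp at this
    rw [hT] at this
    rcases height_succ_snd he x y with h | h
    · exact ⟨by omega, by omega, h.2⟩
    · omega
  refine ⟨x, y, hxy.1.1.1, hxy.1.1.2, ?_⟩
  -- On an edge of the box one step is unavailable, but the conductor makes that half-line meet `S`;
  -- the far corner is excluded, its height being above `k`.
  by_cases hxm : x < m
  · obtain ⟨-, h2, h3, h4⟩ := hx hxm
    refine ⟨⟨hS.isGoodSet.mem_of_meets h3 ?_, fun h => h4 ⟨y, le_rfl, h⟩⟩, h2⟩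
    by_cases hyn : y < n
    · exact (hy hyn).2.2.1
    · exact ⟨m, hxm.le, mem_of_conductor_le hc (by omega) (by omega)⟩
  · by_cases hyn : y < n
    · obtain ⟨-, h2, h3, h4⟩ := hy hyn
      exact ⟨⟨hS.isGoodSet.mem_of_meets ⟨n, hyn.le, mem_of_conductor_le hc (by omega) (by omega)⟩
        h3, fun h => h4 ⟨x, le_rfl, h⟩⟩, h2⟩
    · have := height_eq_of_conductor_le (e := e) hS hc (a := x) (b := y) (by omega) (by omega)
      omega

/-- If the column above an element of `S` meets `S` but not `e + S`, then the next element of `S`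
in that column belongs to the Apéry set and the height grows by at most one up to it. -/
lemma exists_mem_apery_col (hS : IsGood S) (he : e ∈ S) {a b : ℕ}
    (h : MeetsCol S a (b + 1)) (h' : ¬ MeetsCol (translate S e) a b) :
    ∃ y, b < y ∧ (a, y) ∈ apery S e ∧ height S e a y ≤ height S e a b + 1 := by
  classical
  let y := Nat.find h
  obtain ⟨hby, hy⟩ : b + 1 ≤ y ∧ (a, y) ∈ S := Nat.find_spec h
  have hmin : ∀ z, b + 1 ≤ z → z < y → (a, z) ∉ S := fun z hz hlt hmem =>
    Nat.find_min h hlt ⟨hz, hmem⟩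
  refine ⟨y, hby, ⟨hy, fun hmem => h' ⟨y, by omega, hmem⟩⟩, ?_⟩
  -- A counted step at an intermediate `z` needs a row meeting `S`; with `(a, y)` above, the infimum
  -- `(a, z)` would lie in `S`, against minimality of `y`.
  have key : ∀ z, b + 1 ≤ z → z ≤ y → height S e a z ≤ height S e a b + 1 := by
    intro z hz
    induction z, hz using Nat.le_induction with
    | base =>
      intro _
      rcases height_succ_snd he a b with h | h <;> omega
    | succ z hz ih =>
      intro hzy
      rcases height_succ_snd he a z with h | h
      · exact absurd (hS.isGoodSet.mem_of_meets ⟨y, by omega, hy⟩ h.2.1) (hmin z hz (by omega))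
      · have := ih (by omega)
        omega
  exact key y hby le_rfl

lemma exists_mem_apery_row (hS : IsGood S) (he : e ∈ S) {a b : ℕ}
    (h : MeetsRow S (a + 1) b) (h' : ¬ MeetsRow (translate S e) a b) :
    ∃ x, a < x ∧ (x, b) ∈ apery S e ∧ height S e x b ≤ height S e a b + 1 := by
  classical
  let x := Nat.find h
  obtain ⟨hax, hx⟩ : a + 1 ≤ x ∧ (x, b) ∈ S := Nat.find_spec h
  have hmin : ∀ z, a + 1 ≤ z → z < x → (z, b) ∉ S := fun z hz hlt hmem =>
    Nat.find_min h hlt ⟨hz, hmem⟩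
  refine ⟨x, hax, ⟨hx, fun hmem => h' ⟨x, by omega, hmem⟩⟩, ?_⟩
  have key : ∀ z, a + 1 ≤ z → z ≤ x → height S e z b ≤ height S e a b + 1 := by
    intro z hz
    induction z, hz using Nat.le_induction with
    | base =>
      intro _
      rcases height_succ_fst hS he a b with h | h <;> omega
    | succ z hz ih =>
      intro hzy
      rcases height_succ_fst hS he z b with h | h
      · exact absurd (hS.isGoodSet.mem_of_meets h.2.1 ⟨x, by omega, hx⟩) (hmin z hz (by omega))
      · have := ih (by omega)
        omega
  exact key x hax le_rfl

/-- An element of the Apéry set whose height is below `k` either lies strictly below another one of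
height at most `k`, or is the infimum of two others of height at most `k`. -/
lemma exists_above_or_inf (hS : IsGood S) (he : e ∈ S) {a b : ℕ} {k : ℤ}
    (h : (a, b) ∈ apery S e) (hab : height S e a b < k) (hk : k < e.1 + e.2) :
    (∃ x y, a < x ∧ b < y ∧ (x, y) ∈ apery S e ∧ height S e x y ≤ k) ∨
    (∃ x y, a < x ∧ b < y ∧ (a, y) ∈ apery S e ∧ (x, b) ∈ apery S e ∧
      height S e a y = k ∧ height S e x b = k) := by
  by_cases hle : height S e (a + 1) (b + 1) ≤ k
  · obtain ⟨x, y, hx, hy, h1, h2⟩ := exists_mem_apery_height_eq hS he hle hk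
    exact Or.inl ⟨x, y, hx, hy, h1, h2.le⟩
  -- The diagonal step gains 2, so all four sides of the square are counted and `k` is the height at
  -- `(a, b)` plus 1.
  · right
    rcases height_succ_fst hS he a b with ⟨h1, -, hc⟩ | h1
    swap
    · rcases height_succ_snd he (a + 1) b with h2 | h2 <;> omega
    rcases height_succ_snd he a b with ⟨h2, -, hr⟩ | h2
    swap
    · rcases height_succ_fst hS he a (b + 1) with h3 | h3 <;> omega
    rcases height_succ_snd he (a + 1) b with ⟨h3, hr', -⟩ | h3
    swap
    · omega
    obtain ⟨y, hy, hya, hyk⟩ :=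
      exists_mem_apery_col hS he ((hS.isGoodSet.meetsCol_iff_meetsRow h.1).2 hr') hc
    obtain ⟨x, hx, hxa, hxk⟩ := exists_mem_apery_row hS he hr' hr
    have h4 := height_mono hS he (le_refl a) (show b + 1 ≤ y from hy)
    have h5 := height_mono hS he (show a + 1 ≤ x from hx) (le_refl b)
    exact ⟨x, y, hx, hy, hya, hxa, by omega, by omega⟩

/-! ### Layers as level sets of the height -/

lemma mem_maximals_iff {T : Set (ℕ × ℕ)} {α : ℕ × ℕ} :
    α ∈ maximals T ↔ α ∈ T ∧ ∀ β ∈ T, ¬ StrictlyBelow α β := by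
  refine and_congr_right fun _ => forall₂_congr fun β _ => ⟨fun h hlt => ?_, fun h hle => ?_⟩
  · have hne : α ≠ β := fun heq => absurd hlt.1 (by simp [heq])
    exact hne (h (Or.inr ⟨hne, hlt⟩)).symm
  · rcases hle with hle | hle
    · exact hle.symm
    · exact absurd hle.2 h

lemma topLayer_height_le (hS : IsGood S) (he : e ∈ S) {k : ℤ} (hk : k < e.1 + e.2) :
    topLayer {α ∈ apery S e | height S e α.1 α.2 ≤ k} =
      {α ∈ apery S e | height S e α.1 α.2 = k} := by
  set T := {α ∈ apery S e | height S e α.1 α.2 ≤ k}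
  have hmax : ∀ α ∈ apery S e, height S e α.1 α.2 = k → α ∈ maximals T := by
    rintro ⟨a, b⟩ h hab
    refine mem_maximals_iff.2 ⟨⟨h, hab.le⟩, ?_⟩
    rintro ⟨x, y⟩ hxy hlt
    have := height_lt_height hS he h hlt.1 hlt.2
    have := hxy.2
    simp only at *
    omega
  -- In a proper infimum one term lies above in the same column, the other to the right in the same
  -- row.
  have hsplit : ∀ {a b x y u v : ℕ}, (a, b) = (x, y) ⊓ (u, v) → (x, y) ≠ (a, b) →
      (u, v) ≠ (a, b) → (x = a ∧ v = b ∧ a < u ∧ b < y) ∨ (u = a ∧ y = b ∧ a < x ∧ b < v) := by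
    intro a b x y u v h h1 h2
    simp only [Prod.mk_inf_mk, Prod.mk.injEq, ne_eq] at h h1 h2
    omega
  ext ⟨a, b⟩
  constructor
  · rintro ⟨hm, hni⟩
    refine ⟨hm.1.1, ?_⟩
    by_contra hne
    have hlt : height S e a b < k := lt_of_le_of_ne hm.1.2 hne
    rcases exists_above_or_inf hS he hm.1.1 hlt hk with
      ⟨x, y, hx, hy, hxy, hle⟩ | ⟨x, y, hx, hy, hay, hxb, h1, h2⟩
    · exact (mem_maximals_iff.1 hm).2 (x, y) ⟨hxy, hle⟩ ⟨hx, hy⟩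
    · refine hni ⟨hm, (a, y), ⟨hmax _ hay h1, by simp; omega⟩, (x, b),
        ⟨hmax _ hxb h2, by simp; omega⟩, ?_⟩
      simp [hx.le, hy.le]
  · rintro ⟨h, hab⟩
    simp only at hab
    refine ⟨hmax _ h hab, ?_⟩
    rintro ⟨-, ⟨x, y⟩, ⟨hβ, hβne⟩, ⟨u, v⟩, ⟨hγ, hγne⟩, heq⟩
    have hβk : height S e x y ≤ k := hβ.1.2
    have hγk : height S e u v ≤ k := hγ.1.2
    rcases hsplit heq hβne hγne with ⟨rfl, rfl, h1, h2⟩ | ⟨rfl, rfl, h1, h2⟩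
    · have := height_lt_of_height_le hS he h h1 h2 (by omega)
      omega
    · have := height_lt_of_height_le hS he h h1 h2 (by omega)
      omega

lemma height_lt_of_mem_apery (hS : IsGood S) (he : e ∈ S) {α : ℕ × ℕ} (h : α ∈ apery S e) :
    height S e α.1 α.2 < e.1 + e.2 := by
  obtain ⟨c, -, hc⟩ := hS.exists_conductor
  exact (height_lt_height hS he h (show α.1 < α.1 + 1 + c.1 + e.1 by omega)
    (show α.2 < α.2 + 1 + c.2 + e.2 by omega)).trans_eq
    (height_eq_of_conductor_le hS hc (by omega) (by omega))

lemma height_nonneg (hS : IsGood S) (he : e ∈ S) (a b : ℕ) : 0 ≤ height S e a b :=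
  (height_zero S e).symm.le.trans (height_mono hS he (Nat.zero_le _) (Nat.zero_le _))

/-- The layers of the Apéry set are the level sets of the height. -/
lemma layer_apery (hS : IsGood S) (he : e ∈ S) (i : ℕ) (hi : 1 ≤ i) :
    layer (apery S e) i = {α ∈ apery S e | height S e α.1 α.2 = e.1 + e.2 - i} := by
  induction i using Nat.strong_induction_on with
  | _ i ih =>
    rw [layer, ← topLayer_height_le hS he (by omega)]
    congr 1
    ext α
    simp only [Set.mem_sdiff, Set.mem_iUnion, Subtype.exists, not_exists, Set.mem_ofPred_eq]
    refine and_congr_right fun hα => ⟨fun h => ?_, fun h j hj hmem => ?_⟩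
    · by_contra! hlt
      have h0 := height_lt_of_mem_apery hS he hα
      obtain ⟨j, hj⟩ := Int.eq_ofNat_of_zero_le
        (show 0 ≤ (e.1 + e.2 : ℤ) - height S e α.1 α.2 by omega)
      refine h j (by omega) ?_
      rw [ih j (by omega) (by omega)]
      exact ⟨hα, by omega⟩
    · rw [ih j hj.2 hj.1] at hmem
      have := hmem.2
      omega

lemma layer_apery_nonempty_iff (hS : IsGood S) (he : e ∈ S) {i : ℕ} (hi : 1 ≤ i) :
    (layer (apery S e) i).Nonempty ↔ i ≤ e.1 + e.2 := by
  rw [layer_apery hS he i hi]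
  constructor
  · rintro ⟨α, -, h⟩
    have := height_nonneg hS he α.1 α.2
    omega
  · intro hle
    obtain ⟨x, y, -, -, hxy, hk⟩ := exists_mem_apery_height_eq hS he (a := 0) (b := 0)
      (k := e.1 + e.2 - i) (by rw [height_zero]; omega) (by omega)
    exact ⟨(x, y), hxy, hk⟩

end

end GoodSemigroup

open GoodSemigroup in
theorem theorem3p4 (S : AddSubmonoid (ℕ × ℕ)) (hS : GoodSemigroup.IsGood S)
    (hloc : GoodSemigroup.IsLocal S) (e : ℕ × ℕ) (he : GoodSemigroup.IsMinNonzero S e) (N : ℕ) :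
    GoodSemigroup.IsNumberOfLevels S e N ↔ N = e.1 + e.2 := by
  have heS : e ∈ S := he.1.1
  constructor
  · intro h
    refine le_antisymm ?_ ?_
    · rcases Nat.eq_zero_or_pos N with rfl | hN
      · exact Nat.zero_le _
      · have := h.nonempty 1 ⟨le_rfl, hN⟩
        rw [level, Nat.add_sub_cancel] at this
        exact (layer_apery_nonempty_iff hS heS hN).1 this
    · by_contra! hlt
      -- An element of height 0 belongs to layer `e.1 + e.2`, which too small an `N` never reaches.
      obtain ⟨x, y, -, -, hxy, hk⟩ := exists_mem_apery_height_eq hS heS (a := 0) (b := 0) (k := 0)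
        (height_zero S e).le (by omega)
      have hmem := hxy
      rw [← h.iUnion_eq] at hmem
      simp only [Set.mem_iUnion] at hmem
      obtain ⟨i, hi, hmem⟩ := hmem
      rw [level, layer_apery hS heS _ (by have := hi.2; omega)] at hmem
      have := hmem.2
      have := hi.1
      simp only at *
      omega
  · rintro rfl
    refine ⟨fun i hi => ?_, fun i hi j hj hij => ?_, ?_⟩
    · obtain ⟨h1, h2⟩ := hi
      exact (layer_apery_nonempty_iff hS heS (by omega)).2 (by omega)
    · obtain ⟨-, hi⟩ := hi
      obtain ⟨-, hj⟩ := hj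
      refine Set.disjoint_left.2 fun α h1 h2 => hij ?_
      rw [level, layer_apery hS heS _ (by omega)] at h1 h2
      have h3 := h1.2
      have h4 := h2.2
      omega
    · ext α
      simp only [Set.mem_iUnion]
      constructor
      · rintro ⟨i, ⟨-, hi⟩, h⟩
        rw [level, layer_apery hS heS _ (by omega)] at h
        exact h.1
      · intro h
        have h0 := height_nonneg hS heS α.1 α.2
        have h1 := height_lt_of_mem_apery hS heS h
        obtain ⟨j, hj⟩ := Int.eq_ofNat_of_zero_le h0
        refine ⟨j + 1, ⟨by omega, by omega⟩, ?_⟩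
        rw [level, layer_apery hS heS _ (by omega)]
        exact ⟨h, by omega⟩
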